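/- **Theorem (rankwidth of edge-clique graphs of cocktail party graphs).** For a finite graph $G$, the edge-clique graph $K_e(G)$ has the edges of $G$ as its vertices, and two different edges of $G$ are adjacent in $K_e(G)$ when some clique of $G$ contains both of them. The cocktail party graph $cp(n)$ is the complement of the graph on $2n$ vertices whose edges form a perfect matching. A rank-decomposition of a finite graph $H=(V,E)$ is a pair $(T,L)$, where $T$ is a finite tree of maximum degree at most three and $L$ is a bijection from $V$ to the set of leaves (nodes of degree one) of $T$. Deleting an edge $e$ of $T$ splits $T$ into two components and so induces a bipartition $(A_e, V\setminus A_e)$ of $V$; the cut-rank of $A_e$ is the rank over $\mathrm{GF}(2)$ of the $A_e\times(V\setminus A_e)$ submatrix of the adjacency matrix of $H$. The width of $(T,L)$ is the maximum of these cut-ranks over all edges $e$ of $T$, and the rankwidth of $H$ is the minimum width of a rank-decomposition of $H$ (it is $0$ if $|V|\le 1$). The class $\{K_e(cp(n)) : n\in\mathbb{N}\}$ of edge-clique graphs of cocktail party graphs has unbounded rankwidth: for every $k\in\mathbb{N}$ there is an $n\in\mathbb{N}$ such that the rankwidth of $K_e(cp(n))$ is greater than $k$. -/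

import Mathlib

namespace EdgeCliqueRankWidth

/-- The edge-clique graph `K_e(G)`: its vertices are the edges of `G`, and two different edges are
adjacent when some clique of `G` contains both of them. -/
def edgeCliqueGraph {V : Type*} (G : SimpleGraph V) : SimpleGraph G.edgeSet where
  Adj e f := e ≠ f ∧ ∃ s : Set V, G.IsClique s ∧
    (∀ v ∈ (e : Sym2 V), v ∈ s) ∧ (∀ v ∈ (f : Sym2 V), v ∈ s)
  symm.symm _ _ := fun ⟨hne, s, hs, he, hf⟩ => ⟨hne.symm, s, hs, hf, he⟩
  loopless.irrefl _ := fun h => h.1 rfl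

/-- The perfect matching with `n` edges on `2n` vertices: `(i, false)` is matched with
`(i, true)`. -/
def matchingGraph (n : ℕ) : SimpleGraph (Fin n × Bool) where
  Adj x y := x.1 = y.1 ∧ x.2 ≠ y.2
  symm.symm _ _ := fun ⟨h₁, h₂⟩ => ⟨h₁.symm, h₂.symm⟩
  loopless.irrefl _ := fun h => h.2 rfl

/-- The cocktail party graph `cp(n)`: the complement of a matching with `2n` vertices. -/
def cocktailParty (n : ℕ) : SimpleGraph (Fin n × Bool) := (matchingGraph n)ᶜ

open Classical in
/-- The cut-rank of a vertex set `A`: the rank over the field with two elements of the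
`A × (V \ A)` submatrix of the adjacency matrix. -/
noncomputable def cutRank {V : Type*} [Finite V] (G : SimpleGraph V) (A : Set V) : ℕ :=
  letI : Fintype ↥Aᶜ := Fintype.ofFinite _
  (Matrix.of fun (a : A) (b : ↥Aᶜ) => if G.Adj a b then (1 : ZMod 2) else 0).rank

/-- The cut-rank does not depend on the instances chosen in its definition. -/
theorem cutRank_eq {V : Type*} [Finite V] (G : SimpleGraph V) (A : Set V) [Fintype ↥Aᶜ]
    [DecidableRel G.Adj] : cutRank G A =
      (Matrix.of fun (a : A) (b : ↥Aᶜ) => if G.Adj a b then (1 : ZMod 2) else 0).rank := by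
  unfold cutRank
  congr!

/-- A rank-decomposition on the vertex set `V`: a finite tree of maximum degree at most three
together with a bijection from `V` to the leaves (nodes of degree one) of the tree. -/
structure RankDecomposition (V : Type*) where
  Node : Type
  finite_node : Finite Node
  tree : SimpleGraph Node
  isTree : tree.IsTree
  subcubic : ∀ x, (tree.neighborSet x).ncard ≤ 3
  leaf : V ≃ {x : Node // (tree.neighborSet x).ncard = 1}

namespace RankDecomposition

variable {V : Type*}

/-- The vertices of the graph whose leaves lie in the component of `x` after deletion of the tree
edge `xy`. -/
def side (D : RankDecomposition V) (x y : D.Node) : Set V :=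
  {v | (D.tree.deleteEdges {s(x, y)}).Reachable x (D.leaf v)}

/-- The width of a rank-decomposition of `G`: the maximum over the tree edges `xy` of the cut-rank
of the bipartition of `V` that deletion of `xy` induces. -/
noncomputable def width [Finite V] (D : RankDecomposition V) (G : SimpleGraph V) : ℕ :=
  sSup {r | ∃ x y, D.tree.Adj x y ∧ r = cutRank G (D.side x y)}

/-- The supremum in the definition of the width is over a finite, hence bounded, set. -/
theorem cutRank_side_le_width [Finite V] (D : RankDecomposition V) (G : SimpleGraph V)
    {x y : D.Node} (h : D.tree.Adj x y) : cutRank G (D.side x y) ≤ D.width G := by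
  have := D.finite_node
  refine le_csSup (Set.Finite.bddAbove ?_) ⟨x, y, h, rfl⟩
  refine (Set.finite_range fun p : D.Node × D.Node => cutRank G (D.side p.1 p.2)).subset ?_
  rintro r ⟨a, b, -, rfl⟩
  exact ⟨(a, b), rfl⟩

end RankDecomposition

/-- The rankwidth of a finite graph: the minimum width of its rank-decompositions. A graph with at
most one vertex has rankwidth `0`, by convention. -/
noncomputable def rankWidth {V : Type*} [Finite V] (G : SimpleGraph V) : ℕ :=
  sInf {w | ∃ D : RankDecomposition V, w = D.width G}

/-- The convention for graphs with at most one vertex holds. -/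
theorem rankWidth_of_subsingleton {V : Type*} [Finite V] [Subsingleton V] (G : SimpleGraph V) :
    rankWidth G = 0 := by
  have hc : ∀ A : Set V, cutRank G A = 0 := by
    intro A
    classical
    have : Fintype ↥Aᶜ := Fintype.ofFinite _
    have h : (Matrix.of fun (a : A) (b : ↥Aᶜ) => if G.Adj a b then (1 : ZMod 2) else 0) = 0 := by
      ext a b
      exact absurd (Subsingleton.elim (a : V) b ▸ a.2) b.2
    have h' := congrArg Matrix.rank h
    rw [Matrix.rank_zero] at h'
    exact (cutRank_eq G A).trans h'
  unfold rankWidth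
  by_cases h : Nonempty (RankDecomposition V)
  · obtain ⟨D⟩ := h
    have hle : sInf {w | ∃ D : RankDecomposition V, w = D.width G} ≤ D.width G :=
      Nat.sInf_le ⟨D, rfl⟩
    refine Nat.le_zero.1 (hle.trans ?_)
    unfold RankDecomposition.width
    refine csSup_le' ?_
    rintro r ⟨x, y, -, rfl⟩
    exact (hc _).le
  · refine Nat.sInf_eq_zero.2 (Or.inr ?_)
    refine Set.eq_empty_of_forall_notMem ?_
    rintro w ⟨D, -⟩
    exact h ⟨D⟩

end EdgeCliqueRankWidth

/-!
The edge-clique graph of `cp(n)` has about `2n²` vertices, and two of them are non-adjacent exactly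
when one contains a vertex `v` and the other the partner `v̄` of `v` in the deleted matching.

Suppose that a cut `(A, Aᶜ)` has cut-rank at most `k`. The vertices in `Aᶜ` have at most `2 ^ k`
different neighbourhoods in `A` (`exists_twins_of_cutRank_le`), so if `Aᶜ` has more than
`2 ^ k * 8n` elements, more than `8n` of them are twins with respect to `A`, and three of those are
pairwise disjoint edges of `cp(n)`. Let `v` be an endpoint of the first one. An element of `A` that
contains `v̄` is non-adjacent to all three twins, so it has to meet three disjoint pairs, which is
impossible as it has two endpoints. Hence the whole star of `v̄` lies in `Aᶜ`
(`exists_edge_star_subset_compl`). Both sides of a cut cannot contain full stars, because the two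
centres can be chosen to be joined by an edge. So a cut of cut-rank at most `k` has a side with at
most `2 ^ k * 8n` elements.

On the other hand, every subcubic tree has an edge that splits the leaves in a balanced way
(`RankDecomposition.exists_balanced_edge`), and `2n²` outgrows three times `2 ^ k * 8n`. As the
rankwidth is an infimum over all rank-decompositions, it also has to be shown that some
rank-decomposition exists, and a caterpillar serves for that (`RankDecomposition.caterpillar`).
-/

namespace EdgeCliqueRankWidth

/-! ### Deleting an edge from a tree -/

section Tree

variable {N : Type*} {T : SimpleGraph N}

/-- A property that holds at `x` and passes along the edges of `G` out of vertices reachable from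
`x` holds on the whole component of `x`. -/
theorem reachable_induction {G : SimpleGraph N} {x : N} {P : N → Prop} (h0 : P x)
    (hstep : ∀ u v, G.Reachable x u → P u → G.Adj u v → P v) {w : N} (h : G.Reachable x w) :
    P w := by
  rw [SimpleGraph.reachable_iff_reflTransGen] at h
  induction h with
  | refl => exact h0
  | tail hu huv ih => exact hstep _ _ ((SimpleGraph.reachable_iff_reflTransGen _ _).2 hu) ih huv

/-- The component of `x` after deletion of the edge `xy`. -/
def branch (T : SimpleGraph N) (x y : N) : Set N :=
  {w | (T.deleteEdges {s(x, y)}).Reachable x w}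

theorem self_mem_branch (T : SimpleGraph N) (x y : N) : x ∈ branch T x y :=
  SimpleGraph.Reachable.refl _

theorem branch_swap (T : SimpleGraph N) (x y : N) :
    branch T y x = {w | (T.deleteEdges {s(x, y)}).Reachable y w} := by
  rw [branch, Sym2.eq_swap]

theorem mem_branch_of_adj {x y u v : N} (hu : u ∈ branch T x y) (h : T.Adj u v)
    (hne : s(u, v) ≠ s(x, y)) : v ∈ branch T x y :=
  SimpleGraph.Reachable.trans hu
    (SimpleGraph.Adj.reachable (SimpleGraph.deleteEdges_adj.2 ⟨h, hne⟩))

theorem notMem_branch (hT : T.IsTree) {x y : N} (h : T.Adj x y) : y ∉ branch T x y := by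
  have hb := SimpleGraph.isAcyclic_iff_forall_adj_isBridge.1 hT.isAcyclic h
  exact SimpleGraph.isBridge_iff.1 hb

/-- The two branches at an edge of a tree partition the nodes. -/
theorem branch_compl (hT : T.IsTree) {x y : N} (h : T.Adj x y) :
    (branch T x y)ᶜ = branch T y x := by
  ext w
  constructor
  · intro hw
    have key : w ∈ branch T x y ∨ w ∈ branch T y x := by
      refine reachable_induction (G := T) (x := x) (P := fun w => w ∈ branch T x y ∨
        w ∈ branch T y x) (Or.inl (self_mem_branch T x y)) ?_ (hT.connected.preconnected x w)
      intro u v _ hu huv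
      by_cases he : s(u, v) = s(x, y)
      · rcases Sym2.eq_iff.1 he with ⟨-, rfl⟩ | ⟨-, rfl⟩
        · exact Or.inr (self_mem_branch T _ _)
        · exact Or.inl (self_mem_branch T _ _)
      · rcases hu with hu | hu
        · exact Or.inl (mem_branch_of_adj hu huv he)
        · exact Or.inr (mem_branch_of_adj hu huv (by rwa [Sym2.eq_swap (a := y)]))
    exact key.resolve_left hw
  · intro hw hw'
    rw [branch_swap] at hw
    exact notMem_branch hT h (SimpleGraph.Reachable.trans hw' hw.symm)

/-- Passing to a neighbour of `x` other than `y` shrinks the branch. -/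
theorem branch_ssubset (hT : T.IsTree) {x y z : N} (hz : T.Adj x z) (hzy : z ≠ y) :
    branch T z x ⊂ branch T x y := by
  have hx : x ∉ branch T z x := notMem_branch hT hz.symm
  refine ⟨fun w hw => ?_, fun h => hx (h (self_mem_branch T x y))⟩
  refine reachable_induction (P := fun w => w ∈ branch T x y) ?_ ?_ hw
  · refine mem_branch_of_adj (self_mem_branch T x y) hz ?_
    rw [Ne, Sym2.eq_iff]
    rintro (⟨-, rfl⟩ | ⟨rfl, h⟩)
    · exact hzy rfl
    · exact hzy h
  · intro u v hzu hu huv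
    have hzv : v ∈ branch T z x := SimpleGraph.Reachable.trans hzu huv.reachable
    refine mem_branch_of_adj hu (SimpleGraph.deleteEdges_adj.1 huv).1 ?_
    -- the walk stays in the branch of `z`, which avoids `x`
    rw [Ne, Sym2.eq_iff]
    rintro (⟨rfl, -⟩ | ⟨-, rfl⟩)
    · exact hx hzu
    · exact hx hzv

/-- The branch of `x` consists of `x` and the branches of the neighbours of `x` other than `y`. -/
theorem exists_mem_branch {x y w : N} (hw : w ∈ branch T x y) :
    w = x ∨ ∃ z, T.Adj x z ∧ z ≠ y ∧ w ∈ branch T z x := by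
  refine reachable_induction (P := fun w => w = x ∨ ∃ z, T.Adj x z ∧ z ≠ y ∧ w ∈ branch T z x)
    (Or.inl rfl) ?_ hw
  intro u v _ hu hdel
  obtain ⟨huv, hne⟩ := SimpleGraph.deleteEdges_adj.1 hdel
  by_cases hv : v = x
  · exact Or.inl hv
  right
  by_cases hux : u = x
  · subst hux
    exact ⟨v, huv, fun h => hne (by rw [h]; rfl), self_mem_branch T _ _⟩
  · obtain ⟨z, hz, hzy, huz⟩ := hu.resolve_left hux
    refine ⟨z, hz, hzy, mem_branch_of_adj huz huv ?_⟩
    rw [Ne, Sym2.eq_iff]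
    rintro (⟨-, h⟩ | ⟨h, -⟩)
    · exact hv h
    · exact hux h

end Tree

/-! ### Balanced edges of rank-decompositions -/

namespace RankDecomposition

variable {V : Type*}

theorem mem_side {D : RankDecomposition V} {x y : D.Node} {v : V} :
    v ∈ D.side x y ↔ (D.leaf v : D.Node) ∈ branch D.tree x y := Iff.rfl

theorem side_compl (D : RankDecomposition V) {x y : D.Node} (h : D.tree.Adj x y) :
    (D.side x y)ᶜ = D.side y x := by
  ext v
  rw [Set.mem_compl_iff, mem_side, mem_side, ← branch_compl D.isTree h, Set.mem_compl_iff]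

/-- A side with more than `2c ≥ 2` elements at `x` is split further by one of the at most two other
tree edges at `x`: one of the parts has more than `c` elements. -/
theorem exists_large_side [Finite V] (D : RankDecomposition V) {x y : D.Node}
    (h : D.tree.Adj x y) {c : ℕ} (hc : 0 < c) (hs : 2 * c < (D.side x y).ncard) :
    ∃ z, D.tree.Adj x z ∧ z ≠ y ∧ c < (D.side z x).ncard := by
  have := D.finite_node
  by_contra! hno
  set Z : Set D.Node := D.tree.neighborSet x \ {y} with hZ
  have hZcard : Z.ncard + 1 = (D.tree.neighborSet x).ncard :=
    Set.ncard_sdiff_singleton_add_one h (Set.toFinite _)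
  by_cases hx : (D.tree.neighborSet x).ncard = 1
  · have hZ0 : Z = ∅ := (Set.ncard_eq_zero (Set.toFinite _)).1 (by omega)
    have hle : (D.side x y).ncard ≤ 1 := by
      refine (Set.ncard_le_one (Set.toFinite _)).2 fun a ha b hb => ?_
      have aux : ∀ a ∈ D.side x y, (D.leaf a : D.Node) = x := by
        intro a ha
        rcases exists_mem_branch (mem_side.1 ha) with h' | ⟨z, hz, hzy, -⟩
        · exact h'
        · have : z ∈ Z := ⟨hz, hzy⟩
          rw [hZ0] at this
          exact this.elim
      exact D.leaf.injective (Subtype.ext ((aux a ha).trans (aux b hb).symm))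
    omega
  · have hsub : D.side x y ⊆ ⋃ z ∈ Z.toFinite.toFinset, D.side z x := by
      intro a ha
      rcases exists_mem_branch (mem_side.1 ha) with h' | ⟨z, hz, hzy, hza⟩
      · exact (hx (h' ▸ (D.leaf a).2)).elim
      · simp only [Set.mem_iUnion]
        exact ⟨z, Z.toFinite.mem_toFinset.2 ⟨hz, hzy⟩, hza⟩
    have h1 := Set.ncard_le_ncard hsub (Set.toFinite _)
    have h2 := Finset.set_ncard_biUnion_le Z.toFinite.toFinset (fun z => D.side z x)
    have h3 : ∑ z ∈ Z.toFinite.toFinset, (D.side z x).ncard ≤ Z.toFinite.toFinset.card • c :=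
      Finset.sum_le_card_nsmul _ _ _ fun z hz =>
        hno z (Z.toFinite.mem_toFinset.1 hz).1 (Z.toFinite.mem_toFinset.1 hz).2
    rw [← Set.ncard_eq_toFinset_card Z, smul_eq_mul] at h3
    have h4 := D.subcubic x
    have h5 : Z.ncard * c ≤ 2 * c := Nat.mul_le_mul_right _ (by omega)
    omega

/-- If there are more than `3c` leaves, some tree edge has more than `c` of them on either side. -/
theorem exists_balanced_edge [Finite V] (D : RankDecomposition V) {c : ℕ} (hc : 0 < c)
    (hV : 3 * c < Nat.card V) :
    ∃ x y, D.tree.Adj x y ∧ c < (D.side x y).ncard ∧ c < (D.side y x).ncard := by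
  have := D.finite_node
  have hsum : ∀ x y, D.tree.Adj x y → (D.side x y).ncard + (D.side y x).ncard = Nat.card V := by
    intro x y h
    rw [← D.side_compl h]
    exact Set.ncard_add_ncard_compl _
  by_contra! hno
  -- no edge has a large side: descend to ever smaller branches
  have key : ∀ m x y, D.tree.Adj x y → (branch D.tree x y).ncard = m →
      ¬ c < (D.side x y).ncard := by
    intro m
    induction m using Nat.strong_induction_on with
    | _ m ih =>
      intro x y h hm hlt
      have h1 := hno x y h hlt
      have h2 := hsum x y h
      obtain ⟨z, hz, hzy, hzc⟩ := D.exists_large_side h hc (by omega)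
      refine ih _ ?_ z x hz.symm rfl hzc
      rw [← hm]
      exact Set.ncard_lt_ncard (branch_ssubset D.isTree hz hzy) (Set.toFinite _)
  have hne : Nonempty V := (Nat.card_pos_iff.1 (by omega)).1
  obtain ⟨v⟩ := hne
  obtain ⟨y, hy⟩ := Set.ncard_eq_one.1 (D.leaf v).2
  have hxy : D.tree.Adj (D.leaf v) y := by
    have : y ∈ D.tree.neighborSet (D.leaf v) := hy ▸ rfl
    exact this
  have h1 := key _ _ _ hxy rfl
  have h2 := key _ _ _ hxy.symm rfl
  have h3 := hsum _ _ hxy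
  omega

end RankDecomposition

/-! ### Existence of rank-decompositions -/

/-- The caterpillar with `N` leaves: a path on the nodes `(i, false)`, with a pendant node
`(i, true)` attached to each of them. -/
def caterpillarGraph (N : ℕ) : SimpleGraph (Fin N × Bool) where
  Adj x y := (x.1 = y.1 ∧ x.2 ≠ y.2) ∨
    (x.2 = false ∧ y.2 = false ∧ (x.1.val + 1 = y.1.val ∨ y.1.val + 1 = x.1.val))
  symm.symm _ _ := by
    rintro (⟨h, h'⟩ | ⟨h, h', h''⟩)
    · exact Or.inl ⟨h.symm, h'.symm⟩
    · exact Or.inr ⟨h', h, h''.symm⟩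
  loopless.irrefl _ := by
    rintro (⟨-, h⟩ | ⟨-, -, h⟩)
    · exact h rfl
    · omega

theorem caterpillarGraph_adj {N : ℕ} {x y : Fin N × Bool} :
    (caterpillarGraph N).Adj x y ↔ (x.1 = y.1 ∧ x.2 ≠ y.2) ∨
      (x.2 = false ∧ y.2 = false ∧ (x.1.val + 1 = y.1.val ∨ y.1.val + 1 = x.1.val)) := Iff.rfl

theorem caterpillarGraph_connected {N : ℕ} (hN : 0 < N) : (caterpillarGraph N).Connected := by
  have spine : ∀ i (hi : i < N),
      (caterpillarGraph N).Reachable (⟨0, hN⟩, false) (⟨i, hi⟩, false) := by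
    intro i
    induction i with
    | zero => exact fun _ => SimpleGraph.Reachable.refl _
    | succ i ih =>
      intro hi
      refine (ih (by omega)).trans (SimpleGraph.Adj.reachable ?_)
      exact Or.inr ⟨rfl, rfl, Or.inl rfl⟩
  have all : ∀ x, (caterpillarGraph N).Reachable (⟨0, hN⟩, false) x := by
    rintro ⟨⟨i, hi⟩, b⟩
    cases b
    · exact spine i hi
    · exact (spine i hi).trans (SimpleGraph.Adj.reachable (Or.inl ⟨rfl, by simp⟩))
  have : Nonempty (Fin N × Bool) := ⟨(⟨0, hN⟩, false)⟩
  exact ⟨fun x y => (all x).symm.trans (all y)⟩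

theorem caterpillarGraph_isAcyclic (N : ℕ) : (caterpillarGraph N).IsAcyclic := by
  rw [SimpleGraph.isAcyclic_iff_forall_adj_isBridge]
  -- each edge is the only one that leaves a suitable set of nodes
  have sep : ∀ (S : Set (Fin N × Bool)) (x y : Fin N × Bool), x ∈ S → y ∉ S →
      (∀ u v, (caterpillarGraph N).Adj u v → u ∈ S → v ∉ S → u = x ∧ v = y) →
      (caterpillarGraph N).IsBridge s(x, y) := by
    intro S x y hx hy hS
    refine SimpleGraph.isBridge_iff.2 fun hr => hy ?_
    refine reachable_induction (P := fun w => w ∈ S) hx ?_ hr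
    intro u v _ hu huv
    obtain ⟨huv, hne⟩ := SimpleGraph.deleteEdges_adj.1 huv
    by_contra hv
    obtain ⟨rfl, rfl⟩ := hS u v huv hu hv
    exact hne rfl
  have pend : ∀ i : Fin N, (caterpillarGraph N).IsBridge s((i, true), (i, false)) := by
    intro i
    refine sep {(i, true)} _ _ rfl (by simp) ?_
    rintro ⟨a, b⟩ ⟨a', b'⟩ h hu hv
    obtain ⟨rfl, rfl⟩ := Prod.mk.inj hu
    rcases h with ⟨h, h'⟩ | ⟨h, -⟩
    · simp only at h h'
      subst h
      cases b'
      · exact ⟨rfl, rfl⟩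
      · exact (h' rfl).elim
    · exact (Bool.noConfusion h)
  have step : ∀ i j : Fin N, i.val + 1 = j.val →
      (caterpillarGraph N).IsBridge s((i, false), (j, false)) := by
    intro i j hij
    refine sep {x | x.1.val ≤ i.val} _ _ (le_refl i.val) (by simp; omega) ?_
    rintro ⟨a, b⟩ ⟨a', b'⟩ h hu hv
    simp only [Set.mem_ofPred_eq] at hu hv
    rcases h with ⟨h, h'⟩ | ⟨h, h', h''⟩
    · simp only at h
      omega
    · simp only at h h' h''
      subst h h'
      simp only [Prod.mk.injEq, Fin.ext_iff, and_true]
      omega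
  rintro ⟨i, b⟩ ⟨j, b'⟩ (⟨h, h'⟩ | ⟨h, h', h'' | h''⟩)
  · simp only at h h'
    subst h
    cases b <;> cases b'
    · exact (h' rfl).elim
    · rw [Sym2.eq_swap]
      exact pend i
    · exact pend i
    · exact (h' rfl).elim
  · simp only at h h' h''
    subst h h'
    exact step i j h''
  · simp only at h h' h''
    subst h h'
    rw [Sym2.eq_swap]
    exact step j i h''

theorem caterpillarGraph_neighborSet_true {N : ℕ} (i : Fin N) :
    (caterpillarGraph N).neighborSet (i, true) = {(i, false)} := by
  ext ⟨j, b⟩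
  simp only [SimpleGraph.mem_neighborSet, caterpillarGraph_adj, Set.mem_singleton_iff,
    Prod.mk.injEq]
  cases b <;> simp [eq_comm]

theorem caterpillarGraph_ncard_neighborSet_le {N : ℕ} (x : Fin N × Bool) :
    ((caterpillarGraph N).neighborSet x).ncard ≤ 3 := by
  obtain ⟨i, b⟩ := x
  have hsub : (caterpillarGraph N).neighborSet (i, b) ⊆
      {(i, !b)} ∪ ({y | y.2 = false ∧ i.val + 1 = y.1.val} ∪
        {y | y.2 = false ∧ y.1.val + 1 = i.val}) := by
    rintro ⟨j, b'⟩ (⟨h, h'⟩ | ⟨-, h', h'' | h''⟩)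
    · refine Or.inl ?_
      simp only at h h'
      subst h
      cases b <;> cases b' <;> simp_all
    · exact Or.inr (Or.inl ⟨h', h''⟩)
    · exact Or.inr (Or.inr ⟨h', h''⟩)
  have h1 : {y : Fin N × Bool | y.2 = false ∧ i.val + 1 = y.1.val}.ncard ≤ 1 := by
    refine (Set.ncard_le_one (Set.toFinite _)).2 ?_
    rintro ⟨a, b⟩ ⟨h, h'⟩ ⟨a', b'⟩ ⟨k, k'⟩
    simp only at h h' k k'
    exact Prod.ext (Fin.ext (by simp only; omega)) (h.trans k.symm)
  have h2 : {y : Fin N × Bool | y.2 = false ∧ y.1.val + 1 = i.val}.ncard ≤ 1 := by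
    refine (Set.ncard_le_one (Set.toFinite _)).2 ?_
    rintro ⟨a, b⟩ ⟨h, h'⟩ ⟨a', b'⟩ ⟨k, k'⟩
    simp only at h h' k k'
    exact Prod.ext (Fin.ext (by simp only; omega)) (h.trans k.symm)
  have h3 := Set.ncard_le_ncard hsub (Set.toFinite _)
  have h4 := Set.ncard_union_le {(i, !b)} ({y : Fin N × Bool | y.2 = false ∧ i.val + 1 = y.1.val} ∪
        {y | y.2 = false ∧ y.1.val + 1 = i.val})
  have h5 := Set.ncard_union_le {y : Fin N × Bool | y.2 = false ∧ i.val + 1 = y.1.val}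
        {y | y.2 = false ∧ y.1.val + 1 = i.val}
  rw [Set.ncard_singleton] at h4
  omega

/-- With at least two leaves, every node of the spine has a neighbour on the spine besides its
pendant neighbour. -/
theorem caterpillarGraph_ncard_neighborSet_false {N : ℕ} (hN : 2 ≤ N) (i : Fin N) :
    ((caterpillarGraph N).neighborSet (i, false)).ncard ≠ 1 := by
  intro h
  obtain ⟨z, hz⟩ := Set.ncard_eq_one.1 h
  have h1 : (i, true) ∈ (caterpillarGraph N).neighborSet (i, false) := Or.inl ⟨rfl, by simp⟩
  obtain ⟨j, hj⟩ : ∃ j : Fin N, i.val + 1 = j.val ∨ j.val + 1 = i.val := by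
    by_cases hi : i.val + 1 < N
    · exact ⟨⟨i.val + 1, hi⟩, Or.inl rfl⟩
    · refine ⟨⟨i.val - 1, by omega⟩, Or.inr ?_⟩
      simp only
      omega
  have h2 : (j, false) ∈ (caterpillarGraph N).neighborSet (i, false) := Or.inr ⟨rfl, rfl, hj⟩
  rw [hz, Set.mem_singleton_iff] at h1 h2
  have := congrArg Prod.snd (h1.trans h2.symm)
  simp at this

/-- The rank-decomposition of a finite set with at least two elements that is given by a
caterpillar. -/
noncomputable def RankDecomposition.caterpillar (V : Type*) [Finite V] (hV : 2 ≤ Nat.card V) :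
    RankDecomposition V where
  Node := Fin (Nat.card V) × Bool
  finite_node := inferInstance
  tree := caterpillarGraph (Nat.card V)
  isTree := ⟨caterpillarGraph_connected (by omega), caterpillarGraph_isAcyclic _⟩
  subcubic := caterpillarGraph_ncard_neighborSet_le
  leaf := (Finite.equivFin V).trans <| Equiv.ofBijective
    (fun i => ⟨(i, true), by rw [caterpillarGraph_neighborSet_true, Set.ncard_singleton]⟩) <| by
      constructor
      · intro i j h
        exact congrArg (fun x => x.1.1) h
      · rintro ⟨⟨i, b⟩, hb⟩
        cases b
        · exact (caterpillarGraph_ncard_neighborSet_false hV i hb).elim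
        · exact ⟨i, rfl⟩

/-! ### Cuts of small cut-rank -/

/-- A cut-rank of at most `k` allows at most `2 ^ k` different neighbourhoods across the cut, so a
large side contains many vertices with the same neighbours on the other side. -/
theorem exists_twins_of_cutRank_le {V : Type*} [Finite V] (G : SimpleGraph V) (A : Set V)
    {k m : ℕ} (hr : cutRank G A ≤ k) (hA : 2 ^ k * m < (Aᶜ).ncard) :
    ∃ C : Set V, C ⊆ Aᶜ ∧ m < C.ncard ∧ ∀ b ∈ C, ∀ c ∈ C, ∀ a ∈ A, (G.Adj a b ↔ G.Adj a c) := by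
  classical
  have : Fintype ↥Aᶜ := Fintype.ofFinite _
  have : Fintype ↥A := Fintype.ofFinite _
  set M : Matrix A ↥Aᶜ (ZMod 2) :=
    Matrix.of fun (a : A) (b : ↥Aᶜ) => if G.Adj a b then (1 : ZMod 2) else 0 with hM
  rw [cutRank_eq G A] at hr
  have hcard : Fintype.card (LinearMap.range M.mulVecLin) = 2 ^ M.rank := by
    rw [Module.card_eq_pow_finrank (K := ZMod 2), ZMod.card, Matrix.rank]
  have hle : Fintype.card (LinearMap.range M.mulVecLin) ≤ 2 ^ k :=
    hcard.le.trans (Nat.pow_le_pow_right two_pos hr)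
  have hcol : ∀ b : ↥Aᶜ, M.col b ∈ LinearMap.range M.mulVecLin := fun b =>
    ⟨Pi.single b 1, by rw [Matrix.mulVecLin_apply, Matrix.mulVec_single_one]⟩
  have hlt : Fintype.card (LinearMap.range M.mulVecLin) * m < Fintype.card ↥Aᶜ := by
    rw [← Nat.card_eq_fintype_card (α := ↥Aᶜ), Nat.card_coe_set_eq]
    exact (Nat.mul_le_mul_right _ hle).trans_lt hA
  obtain ⟨y, hy⟩ := Fintype.exists_lt_card_fiber_of_mul_lt_card
    (fun b : ↥Aᶜ => (⟨M.col b, hcol b⟩ : LinearMap.range M.mulVecLin)) hlt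
  refine ⟨Subtype.val '' {b : ↥Aᶜ | (⟨M.col b, hcol b⟩ : LinearMap.range M.mulVecLin) = y},
    ?_, ?_, ?_⟩
  · rintro _ ⟨b, -, rfl⟩
    exact b.2
  · rw [Set.ncard_image_of_injective _ Subtype.val_injective, Set.ncard_eq_toFinset_card']
    simpa using hy
  · rintro _ ⟨b, hb, rfl⟩ _ ⟨c, hc, rfl⟩ a ha
    have h1 : M.col b = M.col c := congrArg Subtype.val (hb.trans hc.symm)
    have h2 := congrFun h1 ⟨a, ha⟩
    simp only [Matrix.col_apply, hM, Matrix.of_apply] at h2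
    by_cases hab : G.Adj a b <;> by_cases hac : G.Adj a c <;> simp_all

/-! ### The edge-clique graph of a cocktail party graph -/

/-- The partner of a vertex in the perfect matching. -/
def partner {n : ℕ} (v : Fin n × Bool) : Fin n × Bool := (v.1, !v.2)

theorem partner_partner {n : ℕ} (v : Fin n × Bool) : partner (partner v) = v := by
  simp [partner]

theorem cocktailParty_adj {n : ℕ} {u v : Fin n × Bool} :
    (cocktailParty n).Adj u v ↔ u.1 ≠ v.1 := by
  obtain ⟨i, a⟩ := u
  obtain ⟨j, b⟩ := v
  simp only [cocktailParty, matchingGraph, SimpleGraph.compl_adj, Ne, Prod.mk.injEq]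
  tauto

theorem eq_partner {n : ℕ} {u v : Fin n × Bool} (hne : u ≠ v) (h : ¬ (cocktailParty n).Adj u v) :
    u = partner v := by
  rw [cocktailParty_adj, not_not] at h
  obtain ⟨i, a⟩ := u
  obtain ⟨j, b⟩ := v
  simp only at h
  subst h
  cases a <;> cases b <;> simp_all [partner]

theorem adj_of_mem_edge {V : Type*} {G : SimpleGraph V} (e : G.edgeSet) {u v : V}
    (hu : u ∈ (e : Sym2 V)) (hv : v ∈ (e : Sym2 V)) (hne : u ≠ v) : G.Adj u v := by
  have := (Sym2.mem_and_mem_iff hne).1 ⟨hu, hv⟩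
  rw [← SimpleGraph.mem_edgeSet, ← this]
  exact e.2

/-- Two different edges of `cp(n)` are adjacent in the edge-clique graph unless one of them contains
the partner of an endpoint of the other. -/
theorem edgeCliqueGraph_cocktailParty_adj {n : ℕ} {e f : (cocktailParty n).edgeSet} (hne : e ≠ f) :
    (edgeCliqueGraph (cocktailParty n)).Adj e f ↔
      ∀ v ∈ (f : Sym2 (Fin n × Bool)), partner v ∉ (e : Sym2 (Fin n × Bool)) := by
  constructor
  · rintro ⟨-, s, hs, he, hf⟩ v hv hp
    have hvp : partner v ≠ v := fun h => by simpa [partner] using congrArg Prod.snd h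
    exact cocktailParty_adj.1 (hs (he _ hp) (hf _ hv) hvp) rfl
  · intro h
    have cross : ∀ u ∈ (e : Sym2 (Fin n × Bool)), ∀ v ∈ (f : Sym2 (Fin n × Bool)), u ≠ v →
        (cocktailParty n).Adj u v := by
      intro u hu v hv huv
      by_contra hadj
      exact h v hv (eq_partner huv hadj ▸ hu)
    refine ⟨hne, {v | v ∈ (e : Sym2 (Fin n × Bool)) ∨ v ∈ (f : Sym2 (Fin n × Bool))}, ?_,
      fun v hv => Or.inl hv, fun v hv => Or.inr hv⟩
    rintro u (hu | hu) v (hv | hv) huv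
    · exact adj_of_mem_edge e hu hv huv
    · exact cross u hu v hv huv
    · exact (cross v hv u hu huv.symm).symm
    · exact adj_of_mem_edge f hu hv huv

/-- At most `4n` edges of `cp(n)` have an endpoint in common with a given edge. -/
theorem ncard_meeting_le {n : ℕ} (e : (cocktailParty n).edgeSet) :
    {f : (cocktailParty n).edgeSet | ∃ v ∈ (e : Sym2 (Fin n × Bool)),
      v ∈ (f : Sym2 (Fin n × Bool))}.ncard ≤ 4 * n := by
  have star : ∀ v : Fin n × Bool,
      {f : (cocktailParty n).edgeSet | v ∈ (f : Sym2 (Fin n × Bool))}.ncard ≤ 2 * n := by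
    intro v
    rw [← Set.ncard_image_of_injective _ Subtype.val_injective]
    have hsub : Subtype.val ''
        {f : (cocktailParty n).edgeSet | v ∈ (f : Sym2 (Fin n × Bool))} ⊆
        Set.range fun w => s(v, w) := by
      rintro _ ⟨f, hf, rfl⟩
      obtain ⟨w, hw⟩ := hf
      exact ⟨w, hw.symm⟩
    refine (Set.ncard_le_ncard hsub (Set.toFinite _)).trans ?_
    rw [← Set.image_univ]
    refine (Set.ncard_image_le (Set.toFinite _)).trans ?_
    rw [Set.ncard_univ, Nat.card_eq_fintype_card, Fintype.card_prod, Fintype.card_fin,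
      Fintype.card_bool, mul_comm]
  obtain ⟨e, he⟩ := e
  induction e using Sym2.ind with
  | _ x y =>
    have hsub : {f : (cocktailParty n).edgeSet | ∃ v ∈ s(x, y), v ∈ (f : Sym2 (Fin n × Bool))} ⊆
        {f | x ∈ (f : Sym2 (Fin n × Bool))} ∪ {f | y ∈ (f : Sym2 (Fin n × Bool))} := by
      rintro f ⟨v, hv, hf⟩
      rcases Sym2.mem_iff.1 hv with rfl | rfl
      · exact Or.inl hf
      · exact Or.inr hf
    have h1 := Set.ncard_le_ncard hsub (Set.toFinite _)
    have h2 := Set.ncard_union_le {f : (cocktailParty n).edgeSet | x ∈ (f : Sym2 (Fin n × Bool))}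
      {f | y ∈ (f : Sym2 (Fin n × Bool))}
    have h3 := star x
    have h4 := star y
    simp only
    omega

/-- More than `8n` edges of `cp(n)` include three pairwise disjoint ones. -/
theorem exists_three_disjoint {n : ℕ} {C : Set (cocktailParty n).edgeSet}
    (hC : 8 * n < C.ncard) : ∃ e ∈ C, ∃ f ∈ C, ∃ g ∈ C,
      (∀ v ∈ (e : Sym2 (Fin n × Bool)), v ∉ (f : Sym2 (Fin n × Bool))) ∧
      (∀ v ∈ (e : Sym2 (Fin n × Bool)), v ∉ (g : Sym2 (Fin n × Bool))) ∧
      (∀ v ∈ (f : Sym2 (Fin n × Bool)), v ∉ (g : Sym2 (Fin n × Bool))) := by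
  obtain ⟨e, he⟩ : C.Nonempty := Set.nonempty_of_ncard_ne_zero (by omega)
  have h1 := ncard_meeting_le e
  obtain ⟨f, hf, hf'⟩ := Set.exists_mem_notMem_of_ncard_lt_ncard
    (lt_of_le_of_lt h1 (show _ < C.ncard by omega)) (Set.toFinite _)
  have h2 := ncard_meeting_le f
  have h3 := Set.ncard_union_le
    {g : (cocktailParty n).edgeSet | ∃ v ∈ (e : Sym2 (Fin n × Bool)),
      v ∈ (g : Sym2 (Fin n × Bool))}
    {g : (cocktailParty n).edgeSet | ∃ v ∈ (f : Sym2 (Fin n × Bool)),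
      v ∈ (g : Sym2 (Fin n × Bool))}
  obtain ⟨g, hg, hg'⟩ := Set.exists_mem_notMem_of_ncard_lt_ncard
    (lt_of_le_of_lt (h3.trans (Nat.add_le_add h1 h2)) (show _ < C.ncard by omega))
    (Set.toFinite _)
  exact ⟨e, he, f, hf, g, hg, fun v hv hvf => hf' ⟨v, hv, hvf⟩,
    fun v hv hvg => hg' (Or.inl ⟨v, hv, hvg⟩), fun v hv hvg => hg' (Or.inr ⟨v, hv, hvg⟩)⟩

/-- A large side of a cut of small cut-rank contains the full stars of the partners of both
endpoints of some edge. -/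
theorem exists_edge_star_subset_compl {n k : ℕ} (A : Set (cocktailParty n).edgeSet)
    (hr : cutRank (edgeCliqueGraph (cocktailParty n)) A ≤ k)
    (hA : 2 ^ k * (8 * n) < (Aᶜ).ncard) :
    ∃ e : (cocktailParty n).edgeSet, ∀ v ∈ (e : Sym2 (Fin n × Bool)),
      ∀ a : (cocktailParty n).edgeSet, partner v ∈ (a : Sym2 (Fin n × Bool)) → a ∉ A := by
  obtain ⟨C, hCA, hC, htwin⟩ := exists_twins_of_cutRank_le _ A hr hA
  obtain ⟨e, he, f, hf, g, hg, hef, heg, hfg⟩ := exists_three_disjoint hC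
  refine ⟨e, fun v hv a hva ha => ?_⟩
  have hne : ∀ c ∈ C, a ≠ c := fun c hc h => hCA hc (h ▸ ha)
  have hae : ¬ (edgeCliqueGraph (cocktailParty n)).Adj a e := fun h =>
    (edgeCliqueGraph_cocktailParty_adj (hne e he)).1 h v hv hva
  have hit : ∀ c ∈ C, ∃ w ∈ (c : Sym2 (Fin n × Bool)), partner w ∈ (a : Sym2 (Fin n × Bool)) := by
    intro c hc
    have hac := mt (htwin e he c hc a ha).2 hae
    rw [edgeCliqueGraph_cocktailParty_adj (hne c hc)] at hac
    push Not at hac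
    exact hac
  obtain ⟨w, hw, hwa⟩ := hit f hf
  obtain ⟨z, hz, hza⟩ := hit g hg
  -- `a` would have three different endpoints, the partners of `v`, `w` and `z`
  have hinj : ∀ {p q : Fin n × Bool}, partner p = partner q → p = q := fun {p q} h => by
    rw [← partner_partner p, h, partner_partner]
  have hvw : partner v ≠ partner w := fun h => hef v hv (hinj h ▸ hw)
  have hvz : partner v ≠ partner z := fun h => heg v hv (hinj h ▸ hz)
  have hwz : partner w ≠ partner z := fun h => hfg w hw (hinj h ▸ hz)
  rw [(Sym2.mem_and_mem_iff hvw).1 ⟨hva, hwa⟩, Sym2.mem_iff] at hza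
  rcases hza with h | h
  · exact hvz h.symm
  · exact hwz h.symm

theorem exists_mem_edge_fst_ne {n : ℕ} (e : (cocktailParty n).edgeSet) (i : Fin n) :
    ∃ v ∈ (e : Sym2 (Fin n × Bool)), v.1 ≠ i := by
  obtain ⟨e, he⟩ := e
  induction e using Sym2.ind with
  | _ x y =>
    have hxy := cocktailParty_adj.1 ((SimpleGraph.mem_edgeSet _).1 he)
    by_cases hx : x.1 = i
    · exact ⟨y, Sym2.mem_mk_right x y, fun hy => hxy (hx.trans hy.symm)⟩
    · exact ⟨x, Sym2.mem_mk_left x y, hx⟩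

/-- If `cp(n)` has enough edges, the balanced edge of any rank-decomposition gives a cut of large
cut-rank, because two full stars cannot lie on opposite sides of it. -/
theorem lt_width_of_card {n k : ℕ} (hn : 0 < n)
    (hcard : 3 * (2 ^ k * (8 * n)) < Nat.card (cocktailParty n).edgeSet)
    (D : RankDecomposition (cocktailParty n).edgeSet) :
    k < D.width (edgeCliqueGraph (cocktailParty n)) := by
  by_contra! hw
  obtain ⟨x, y, hxy, h1, h2⟩ := D.exists_balanced_edge (c := 2 ^ k * (8 * n)) (by positivity) hcard
  rw [← D.side_compl hxy.symm] at h1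
  rw [← D.side_compl hxy] at h2
  obtain ⟨e, he⟩ := exists_edge_star_subset_compl _
    ((D.cutRank_side_le_width _ hxy.symm).trans hw) h1
  obtain ⟨f, hf⟩ := exists_edge_star_subset_compl _ ((D.cutRank_side_le_width _ hxy).trans hw) h2
  have hu : ∃ u, u ∈ (f : Sym2 (Fin n × Bool)) := ⟨_, Sym2.out_fst_mem _⟩
  obtain ⟨u, hu⟩ := hu
  obtain ⟨v, hv, hvu⟩ := exists_mem_edge_fst_ne e u.1
  have hadj : (cocktailParty n).Adj (partner v) (partner u) := cocktailParty_adj.2 hvu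
  -- the edge between the centres of the two stars lies on neither side
  have hside := he v hv ⟨s(partner v, partner u), hadj⟩ (Sym2.mem_mk_left _ _)
  have hside' := hf u hu ⟨s(partner v, partner u), hadj⟩ (Sym2.mem_mk_right _ _)
  rw [← D.side_compl hxy] at hside
  exact hside hside'

/-- The edges `(i, false)(j, true)` with `i ≠ j` already number `n(n - 1)`. -/
theorem mul_self_sub_le_card_edgeSet (n : ℕ) : n * n - n ≤ Nat.card (cocktailParty n).edgeSet := by
  have hoff : n * n - n = Nat.card {p : Fin n × Fin n // p ∈ Finset.univ.offDiag} := by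
    rw [Nat.card_eq_fintype_card, Fintype.card_coe, Finset.offDiag_card, Finset.card_univ,
      Fintype.card_fin]
  rw [hoff]
  refine Nat.card_le_card_of_injective (fun p => ⟨s((p.1.1, false), (p.1.2, true)),
    cocktailParty_adj.2 (Finset.mem_offDiag.1 p.2).2.2⟩) ?_
  rintro ⟨⟨i, j⟩, hp⟩ ⟨⟨i', j'⟩, hq⟩ h
  have h' := Sym2.eq_iff.1 (congrArg Subtype.val h)
  simp only [Prod.mk.injEq] at h'
  simp_all

end EdgeCliqueRankWidth

theorem mainTheorem5 :
    ∀ k : ℕ, ∃ n : ℕ,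
      k < EdgeCliqueRankWidth.rankWidth
        (EdgeCliqueRankWidth.edgeCliqueGraph (EdgeCliqueRankWidth.cocktailParty n)) := by
  intro k
  -- the least `n` with `n * (n - 1) > 3 * (2 ^ k * (8 * n))`
  obtain ⟨n, hn⟩ : ∃ n, n = 24 * 2 ^ k + 2 := ⟨_, rfl⟩
  refine ⟨n, ?_⟩
  have hcard : 3 * (2 ^ k * (8 * n)) <
      Nat.card (EdgeCliqueRankWidth.cocktailParty n).edgeSet := by
    refine lt_of_lt_of_le ?_ (EdgeCliqueRankWidth.mul_self_sub_le_card_edgeSet n)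
    have h : n * n = 3 * (2 ^ k * (8 * n)) + 2 * n := by
      calc n * n = (24 * 2 ^ k + 2) * n := by rw [← hn]
        _ = _ := by ring
    omega
  have hpos : 0 < 2 ^ k * (8 * n) := by
    have : 0 < n := by omega
    positivity
  -- the infimum is attained, because rank-decompositions exist
  obtain ⟨D, hD⟩ := Nat.sInf_mem (s := {w | ∃ D : EdgeCliqueRankWidth.RankDecomposition
    (EdgeCliqueRankWidth.cocktailParty n).edgeSet,
    w = D.width (EdgeCliqueRankWidth.edgeCliqueGraph (EdgeCliqueRankWidth.cocktailParty n))})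
    ⟨_, EdgeCliqueRankWidth.RankDecomposition.caterpillar _ (by omega), rfl⟩
  rw [EdgeCliqueRankWidth.rankWidth, hD]
  exact EdgeCliqueRankWidth.lt_width_of_card (by omega) hcard D
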